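/- Let $\mathcal A:\mathbb R^n\to\mathbb R^m$ be linear, $b\in\mathbb R^m$, let $G_1,\dots,G_g$ be pairwise disjoint index sets whose union is $\{1,\dots,n\}$, let $w_1,\dots,w_g>0$, and let $\lambda_1,\lambda_2\ge 0$ with $\lambda_1+\lambda_2>0$. Define on $\mathbb R^n$ $$f(x)=\tfrac12\|\mathcal Ax-b\|^2,\qquad p(x)=\lambda_1\|x\|_1+\lambda_2\sum_{l=1}^g w_l\|x_{G_l}\|,$$ where $\|\cdot\|$ is the Euclidean norm and $x_{G_l}$ is the restriction of $x$ to the indices in $G_l$. Let $\Omega_P$ be the set of global minimizers of $f+p$ over $\mathbb R^n$, and let $\mathcal T(x)=\nabla f(x)+\partial p(x)$, where $\partial p(x)=\{u : p(y)\ge p(x)+\langle u,y-x\rangle\ \text{for all } y\in\mathbb R^n\}$. With $\operatorname{dist}(x,S)=\inf_{y\in S}\|x-y\|$, the sets $\Omega_P$ and $\mathcal T(x)$ below are nonempty, and for every $r>0$ there exists $\kappa>0$ such that $$\operatorname{dist}(x,\Omega_P)\le\kappa\,\operatorname{dist}(0,\mathcal T(x))\qquad\text{for all }x\in\mathbb R^n\text{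 with }\operatorname{dist}(x,\Omega_P)\le r.$$ -/

import Mathlib

noncomputable section

namespace SGLasso

/-- The smooth part `f(x) = (1/2) ‖A x - b‖²` of the objective (Euclidean norm). -/
def loss {n m : ℕ} (A : EuclideanSpace ℝ (Fin n) →ₗ[ℝ] EuclideanSpace ℝ (Fin m))
    (b : EuclideanSpace ℝ (Fin m)) (x : EuclideanSpace ℝ (Fin n)) : ℝ :=
  (1 / 2 : ℝ) * ‖A x - b‖ ^ 2

/-- The restriction `x_S` of a vector to an index set `S`, as a Euclidean vector. -/
def restrict {n : ℕ} (S : Finset (Fin n)) (x : EuclideanSpace ℝ (Fin n)) :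
    EuclideanSpace ℝ S :=
  WithLp.toLp 2 (fun i : S => x i)

/-- The sparse group Lasso regularizer
`p(x) = lam1 * ‖x‖₁ + lam2 * ∑ l, w l * ‖x_{G l}‖`. -/
def regularizer {n g : ℕ} (G : Fin g → Finset (Fin n)) (w : Fin g → ℝ) (lam1 lam2 : ℝ)
    (x : EuclideanSpace ℝ (Fin n)) : ℝ :=
  lam1 * ∑ i, |x i| + lam2 * ∑ l, w l * ‖restrict (G l) x‖

/-- The convex subdifferential `∂p(x)` of a real-valued function. -/
def subdifferential {E : Type*} [NormedAddCommGroup E] [InnerProductSpace ℝ E]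
    (p : E → ℝ) (x : E) : Set E :=
  {v | ∀ y, p x + inner ℝ v (y - x) ≤ p y}

/-- The set of global minimizers of a real-valued function. -/
def minimizers {E : Type*} (h : E → ℝ) : Set E :=
  {x | ∀ y, h x ≤ h y}

/-- The optimal solution set of `min f + p` over `ℝⁿ`. -/
def solutionSet {n m g : ℕ} (A : EuclideanSpace ℝ (Fin n) →ₗ[ℝ] EuclideanSpace ℝ (Fin m))
    (b : EuclideanSpace ℝ (Fin m)) (G : Fin g → Finset (Fin n)) (w : Fin g → ℝ)
    (lam1 lam2 : ℝ) : Set (EuclideanSpace ℝ (Fin n)) :=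
  minimizers (fun x => loss A b x + regularizer G w lam1 lam2 x)

/-- The set-valued map `T(x) = ∇f(x) + ∂p(x)`. -/
def optimalityMap {n m g : ℕ} (A : EuclideanSpace ℝ (Fin n) →ₗ[ℝ] EuclideanSpace ℝ (Fin m))
    (b : EuclideanSpace ℝ (Fin m)) (G : Fin g → Finset (Fin n)) (w : Fin g → ℝ)
    (lam1 lam2 : ℝ) (x : EuclideanSpace ℝ (Fin n)) : Set (EuclideanSpace ℝ (Fin n)) :=
  {v | ∃ u ∈ subdifferential (regularizer G w lam1 lam2) x, v = gradient (loss A b) x + u}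

end SGLasso

end

/-!
Write `F = f + p`, fix a minimizer `x₀` and put `u = -∇f(x₀)`. Since `f` is quadratic and `p` is
positively homogeneous, Fermat's rule says that `p x₀ = ⟪u, x₀⟫` and `⟪u, ·⟫ ≤ p`, and it gives
the exact identity `F x - F x₀ = ½ ‖A x - A x₀‖² + (p x - ⟪u, x⟫)` (`objective_sub_eq`). Hence the
solution set is the intersection of the affine space `A x = A x₀` with the face
`{x | p x = ⟪u, x⟫}` of `p`.

The point is that this face is polyhedral although `p` is not: every group contributes a single ray
or only the origin (`exists_face_parametrization`). This comes from splitting `u` by soft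
thresholding into a subgradient of the `ℓ¹` term and one of the group terms, and from the elementary
identity `‖x - (‖x‖ / c) • s‖² = 2 (‖x‖ / c) (c ‖x‖ - ⟪s, x⟫)` for `‖s‖ = c`, which also shows that
the gap `p x - ⟪u, x⟫` dominates the squared distance to the face on bounded sets. Parametrizing the
face linearly by a nonnegative orthant and applying Hoffman's bound there
(`exists_nonneg_solution_norm_sub_le`), one obtains
`dist(x, Ω)² ≤ C (F x - min F)` on bounded sets (`exists_infDist_sq_le_mul_objective_sub`).

Convexity gives `F x - min F ≤ ‖v‖ dist(x, Ω)` for every `v ∈ T(x)`, and dividing by `dist(x, Ω)`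
yields the error bound. Boundedness of the solution set comes from the coercivity of `p`. When
`lam2 = 0`, the `ℓ¹` norm is regarded as the sum of the group norms of the singletons.
-/

namespace SGLasso

open Filter Topology

/-! ### Hoffman's bound for the nonnegative solutions of a linear system -/

theorem exists_norm_le_mul_norm_map_of_cone {E F : Type*} [NormedAddCommGroup E]
    [NormedSpace ℝ E] [FiniteDimensional ℝ E] [NormedAddCommGroup F] [NormedSpace ℝ F]
    (B : E →ₗ[ℝ] F) {K : Set E} (hK : IsClosed K)
    (hcone : ∀ c : ℝ, 0 < c → ∀ k ∈ K, c • k ∈ K) (hker : ∀ k ∈ K, B k = 0 → k = 0) :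
    ∃ C : ℝ, 0 ≤ C ∧ ∀ k ∈ K, ‖k‖ ≤ C * ‖B k‖ := by
  have hB : Continuous B := B.continuous_of_finiteDimensional
  have : ProperSpace E := FiniteDimensional.proper ℝ E
  have hcomp : IsCompact (Metric.sphere (0 : E) 1 ∩ K) := (isCompact_sphere 0 1).inter_right hK
  rcases (Metric.sphere (0 : E) 1 ∩ K).eq_empty_or_nonempty with hempty | hne
  · refine ⟨0, le_rfl, fun k hk => ?_⟩
    by_contra! h
    have hk0 : 0 < ‖k‖ := by simpa using h
    have : ‖k‖⁻¹ • k ∈ Metric.sphere (0 : E) 1 ∩ K :=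
      ⟨by simp [norm_smul, hk0.ne'], hcone _ (inv_pos.2 hk0) k hk⟩
    simp [hempty] at this
  · obtain ⟨k₀, ⟨hk₀, hk₀K⟩, hmin⟩ := hcomp.exists_isMinOn hne hB.norm.continuousOn
    have hpos : 0 < ‖B k₀‖ := by
      rw [norm_pos_iff]
      intro h
      simp [hker k₀ hk₀K h] at hk₀
    refine ⟨‖B k₀‖⁻¹, by positivity, fun k hk => ?_⟩
    rcases eq_or_ne k 0 with rfl | hk0
    · simp
    have hk0 : 0 < ‖k‖ := norm_pos_iff.2 hk0
    have h : ‖B k₀‖ ≤ ‖B (‖k‖⁻¹ • k)‖ :=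
      hmin ⟨by simp [norm_smul, hk0.ne'], hcone _ (inv_pos.2 hk0) k hk⟩
    rw [map_smul, norm_smul, norm_inv, norm_norm, inv_mul_eq_div, le_div_iff₀ hk0] at h
    rw [inv_mul_eq_div, le_div_iff₀ hpos]
    linarith

/-- Every vector `z` has the same image under `B` as some vector `y` which lies coordinatewise
between `0` and `z` and is controlled in norm by that image. The vector `y` is chosen of minimal
`ℓ¹` norm; then no nonzero element of the kernel of `B` has the sign pattern of `y`, so that `B`
is bounded below on the closed orthant face of that pattern. There are finitely many patterns. -/
theorem exists_conformal_norm_le {ι F : Type*} [Fintype ι] [NormedAddCommGroup F]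
    [NormedSpace ℝ F] (B : (ι → ℝ) →ₗ[ℝ] F) :
    ∃ C : ℝ, 0 ≤ C ∧ ∀ z : ι → ℝ, ∃ y : ι → ℝ, B y = B z ∧
      (∀ i, |y i| + |z i - y i| = |z i|) ∧ ‖y‖ ≤ C * ‖B z‖ := by
  classical
  have hB : Continuous B := B.continuous_of_finiteDimensional
  let K : (ι → SignType) → Set (ι → ℝ) := fun σ => {k | ∀ i, |k i| = (σ i : ℝ) * k i}
  have hKclosed : ∀ σ, IsClosed (K σ) := fun σ => by
    simp only [K, Set.ofPred_forall]
    exact isClosed_iInter fun i => isClosed_eq (by fun_prop) (by fun_prop)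
  have hKcone : ∀ σ, ∀ c : ℝ, 0 < c → ∀ k ∈ K σ, c • k ∈ K σ := by
    intro σ c hc k hk i
    simp only [Pi.smul_apply, smul_eq_mul, abs_mul, abs_of_pos hc, hk i]
    ring
  have hex : ∀ σ, ∃ C : ℝ, 0 ≤ C ∧
      ((∀ k ∈ K σ, B k = 0 → k = 0) → ∀ k ∈ K σ, ‖k‖ ≤ C * ‖B k‖) := by
    intro σ
    by_cases h : ∀ k ∈ K σ, B k = 0 → k = 0
    · obtain ⟨C, hC, hbd⟩ := exists_norm_le_mul_norm_map_of_cone B (hKclosed σ) (hKcone σ) h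
      exact ⟨C, hC, fun _ => hbd⟩
    · exact ⟨0, le_rfl, fun h' => absurd h' h⟩
  choose C hC hbd using hex
  refine ⟨∑ σ, C σ, Finset.sum_nonneg fun σ _ => hC σ, fun z => ?_⟩
  let S : Set (ι → ℝ) := {y | B y = B z ∧ ∀ i, |y i| + |z i - y i| = |z i|}
  have hSclosed : IsClosed S := by
    have hconf : IsClosed {y : ι → ℝ | ∀ i, |y i| + |z i - y i| = |z i|} := by
      simp only [Set.ofPred_forall]
      exact isClosed_iInter fun i => isClosed_eq (by fun_prop) (by fun_prop)
    exact (isClosed_eq hB continuous_const).inter hconf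
  have hScomp : IsCompact S := by
    refine Metric.isCompact_of_isClosed_isBounded hSclosed
      ((Metric.isBounded_closedBall (x := (0 : ι → ℝ)) (r := ‖z‖)).subset fun y hy => ?_)
    rw [mem_closedBall_zero_iff, pi_norm_le_iff_of_nonneg (norm_nonneg z)]
    intro i
    have h1 := hy.2 i
    have h2 := norm_le_pi_norm z i
    rw [Real.norm_eq_abs] at h2 ⊢
    linarith [abs_nonneg (z i - y i)]
  obtain ⟨y, hyS, hmin⟩ := hScomp.exists_isMinOn ⟨z, rfl, by simp⟩
    (f := fun y : ι → ℝ => ∑ i, |y i|) (by fun_prop)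
  refine ⟨y, hyS.1, hyS.2, ?_⟩
  let σ : ι → SignType := fun i => SignType.sign (y i)
  have hyK : y ∈ K σ := fun i => (sign_mul_self (y i)).symm
  have hker : ∀ k ∈ K σ, B k = 0 → k = 0 := by
    intro k hk hBk
    by_contra hk0
    -- For small `ε`, the vector `y - ε • k` is a competitor of smaller `ℓ¹` norm.
    have hev : ∀ᶠ ε : ℝ in 𝓝[>] 0, ∀ i, ε * |k i| ≤ |y i| := by
      rw [eventually_all]
      intro i
      rcases eq_or_ne (y i) 0 with h0 | h0
      · have : |k i| = 0 := by rw [hk i]; simp [σ, h0]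
        simp [this]
      · have ht : Tendsto (fun ε : ℝ => ε * |k i|) (𝓝[>] 0) (𝓝 (0 * |k i|)) :=
          (tendsto_id.mul_const _).mono_left nhdsWithin_le_nhds
        rw [zero_mul] at ht
        exact (ht.eventually_lt_const (abs_pos.2 h0)).mono fun _ h => h.le
    obtain ⟨ε, hε, hεpos⟩ := (hev.and self_mem_nhdsWithin).exists
    have hεpos : 0 < ε := hεpos
    have habs : ∀ i, |y i - ε * k i| = |y i| - ε * |k i| := by
      intro i
      have h1 := hε i
      have h2 := hk i
      rcases lt_trichotomy (y i) 0 with h | h | h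
      · simp only [σ, sign_neg h, SignType.coe_neg, SignType.coe_one] at h2
        rw [abs_of_neg h] at h1 ⊢
        rw [h2] at h1 ⊢
        rw [abs_of_nonpos (by linarith)]
        ring
      · simp only [σ, h, sign_zero, SignType.coe_zero, zero_mul, abs_eq_zero] at h2
        simp [h2]
      · simp only [σ, sign_pos h, SignType.coe_one, one_mul] at h2
        rw [abs_of_pos h] at h1 ⊢
        rw [h2] at h1 ⊢
        rw [abs_of_nonneg (by linarith)]
    have hmem : y - ε • k ∈ S := by
      refine ⟨by simp [hBk, hyS.1], fun i => ?_⟩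
      have h1 := hyS.2 i
      have h2 : |z i - (y i - ε * k i)| ≤ |z i - y i| + ε * |k i| := by
        have := abs_add_le (z i - y i) (ε * k i)
        rwa [abs_mul, abs_of_pos hεpos,
          show z i - y i + ε * k i = z i - (y i - ε * k i) by ring] at this
      have h3 := abs_add_le (y i - ε * k i) (z i - (y i - ε * k i))
      rw [add_sub_cancel] at h3
      have h4 := habs i
      simp only [Pi.sub_apply, Pi.smul_apply, smul_eq_mul]
      linarith
    have hle : ∑ i, |y i| ≤ ∑ i, |(y - ε • k) i| := hmin hmem
    simp only [Pi.sub_apply, Pi.smul_apply, smul_eq_mul, habs, Finset.sum_sub_distrib,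
      ← Finset.mul_sum] at hle
    have hsum : ∑ i, |k i| ≤ 0 := by
      by_contra! h
      linarith [mul_pos hεpos h]
    apply hk0
    ext i
    have := Finset.single_le_sum (f := fun i => |k i|) (fun i _ => abs_nonneg _)
      (Finset.mem_univ i)
    exact abs_nonpos_iff.1 (this.trans hsum)
  calc ‖y‖ ≤ C σ * ‖B y‖ := hbd σ hker y hyK
    _ ≤ (∑ σ, C σ) * ‖B z‖ := by
      rw [hyS.1]
      exact mul_le_mul_of_nonneg_right
        (Finset.single_le_sum (fun σ _ => hC σ) (Finset.mem_univ σ)) (norm_nonneg _)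

/-- **Hoffman's bound** for `{t | 0 ≤ t, B t = B t₀}`, evaluated at nonnegative vectors. -/
theorem exists_nonneg_solution_norm_sub_le {ι F : Type*} [Fintype ι] [NormedAddCommGroup F]
    [NormedSpace ℝ F] (B : (ι → ℝ) →ₗ[ℝ] F) :
    ∃ C : ℝ, 0 ≤ C ∧ ∀ t t₀ : ι → ℝ, 0 ≤ t → 0 ≤ t₀ →
      ∃ s : ι → ℝ, 0 ≤ s ∧ B s = B t₀ ∧ ‖t - s‖ ≤ C * ‖B t - B t₀‖ := by
  obtain ⟨C, hC, h⟩ := exists_conformal_norm_le B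
  refine ⟨C, hC, fun t t₀ ht ht₀ => ?_⟩
  obtain ⟨y, hy, hconf, hbd⟩ := h (t₀ - t)
  refine ⟨t + y, fun i => ?_, by simp [hy], ?_⟩
  · have h1 := hconf i
    have h2 := ht i
    have h3 := ht₀ i
    simp only [Pi.sub_apply, Pi.zero_apply, Pi.add_apply] at h1 h2 h3 ⊢
    rcases abs_cases (y i) with h4 | h4
    · linarith
    · rcases abs_cases (t₀ i - t i) with h5 | h5 <;>
        linarith [neg_abs_le (t₀ i - t i - y i), le_abs_self (t₀ i - t i - y i)]
  · simpa [norm_sub_rev (B t)] using hbd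

/-! ### Growth of a norm above one of its supporting linear forms -/

/-- If `‖s‖ ≤ c`, the function `c * ‖x‖ - ⟪s, x⟫` vanishes exactly on the ray spanned by `s` when
`‖s‖ = c`, and only at `0` otherwise. On bounded sets it dominates the squared distance to that
cone. -/
theorem exists_norm_sub_ray_sq_le {E : Type*} [NormedAddCommGroup E] [InnerProductSpace ℝ E]
    (s : E) {c : ℝ} (hc : 0 < c) (hs : ‖s‖ ≤ c) {R : ℝ} (hR : 0 ≤ R) :
    ∃ C : ℝ, 0 ≤ C ∧ ∀ x : E, ‖x‖ ≤ R → ∃ t : ℝ, 0 ≤ t ∧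
      ‖x - t • (if ‖s‖ = c then s else 0)‖ ^ 2 ≤ C * (c * ‖x‖ - inner ℝ s x) := by
  by_cases h : ‖s‖ = c
  · refine ⟨2 * R / c, by positivity, fun x hx => ⟨‖x‖ / c, by positivity, ?_⟩⟩
    have hgap : 0 ≤ c * ‖x‖ - inner ℝ s x := by
      have := real_inner_le_norm s x
      rw [h] at this
      linarith
    have heq : ‖x - (‖x‖ / c) • s‖ ^ 2 = 2 * ‖x‖ / c * (c * ‖x‖ - inner ℝ s x) := by
      rw [norm_sub_sq_real, inner_smul_right, norm_smul, Real.norm_of_nonneg (by positivity), h,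
        real_inner_comm]
      field_simp
      ring
    rw [if_pos h, heq]
    gcongr
  · have hlt : 0 < c - ‖s‖ := sub_pos.2 (lt_of_le_of_ne hs h)
    refine ⟨R / (c - ‖s‖), by positivity, fun x hx => ⟨0, le_rfl, ?_⟩⟩
    have hgap : (c - ‖s‖) * ‖x‖ ≤ c * ‖x‖ - inner ℝ s x := by
      linarith [real_inner_le_norm s x]
    calc ‖x - (0 : ℝ) • (if ‖s‖ = c then s else 0)‖ ^ 2 = ‖x‖ * ‖x‖ := by simp [sq]
      _ ≤ R * ‖x‖ := by gcongr
      _ = R / (c - ‖s‖) * ((c - ‖s‖) * ‖x‖) := by field_simp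
      _ ≤ R / (c - ‖s‖) * (c * ‖x‖ - inner ℝ s x) := by gcongr

/-! ### The quadratic loss -/

theorem inner_gradient_loss {n m : ℕ}
    (A : EuclideanSpace ℝ (Fin n) →ₗ[ℝ] EuclideanSpace ℝ (Fin m))
    (b : EuclideanSpace ℝ (Fin m)) (x h : EuclideanSpace ℝ (Fin n)) :
    inner ℝ (gradient (loss A b) x) h = inner ℝ (A x - b) (A h) := by
  have hd : HasFDerivAt (loss A b) _ x :=
    ((A.toContinuousLinearMap.hasFDerivAt (x := x)).sub_const b).norm_sq.const_mul (1 / 2 : ℝ)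
  rw [gradient, InnerProductSpace.toDual_symm_apply, hd.fderiv]
  simp [inner_sub_left]

theorem loss_eq_add_inner_gradient {n m : ℕ}
    (A : EuclideanSpace ℝ (Fin n) →ₗ[ℝ] EuclideanSpace ℝ (Fin m))
    (b : EuclideanSpace ℝ (Fin m)) (x y : EuclideanSpace ℝ (Fin n)) :
    loss A b y = loss A b x + inner ℝ (gradient (loss A b) x) (y - x) +
      1 / 2 * ‖A (y - x)‖ ^ 2 := by
  rw [inner_gradient_loss, loss, loss,
    show A y - b = (A x - b) + A (y - x) by rw [map_sub]; abel, norm_add_sq_real]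
  ring

theorem continuous_loss {n m : ℕ}
    (A : EuclideanSpace ℝ (Fin n) →ₗ[ℝ] EuclideanSpace ℝ (Fin m))
    (b : EuclideanSpace ℝ (Fin m)) : Continuous (loss A b) := by
  have hA : Continuous A := A.continuous_of_finiteDimensional
  unfold loss
  fun_prop

/-! ### The regularizer and its subgradients -/

section Regularizer

variable {n g : ℕ}

theorem restrict_apply (S : Finset (Fin n)) (x : EuclideanSpace ℝ (Fin n)) (i : S) :
    restrict S x i = x i := rfl

theorem restrict_add (S : Finset (Fin n)) (x y : EuclideanSpace ℝ (Fin n)) :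
    restrict S (x + y) = restrict S x + restrict S y := rfl

theorem restrict_sub (S : Finset (Fin n)) (x y : EuclideanSpace ℝ (Fin n)) :
    restrict S (x - y) = restrict S x - restrict S y := rfl

theorem restrict_smul (S : Finset (Fin n)) (c : ℝ) (x : EuclideanSpace ℝ (Fin n)) :
    restrict S (c • x) = c • restrict S x := rfl

theorem continuous_restrict (S : Finset (Fin n)) : Continuous (restrict S) := by
  unfold restrict
  fun_prop

theorem inner_restrict (S : Finset (Fin n)) (x y : EuclideanSpace ℝ (Fin n)) :
    inner ℝ (restrict S x) (restrict S y) = ∑ i ∈ S, x i * y i := by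
  rw [PiLp.inner_apply, ← Finset.sum_coe_sort S]
  simp [restrict, mul_comm]

theorem norm_restrict_le (S : Finset (Fin n)) (x : EuclideanSpace ℝ (Fin n)) :
    ‖restrict S x‖ ≤ ‖x‖ := by
  rw [← sq_le_sq₀ (norm_nonneg _) (norm_nonneg _), ← real_inner_self_eq_norm_sq, inner_restrict,
    EuclideanSpace.real_norm_sq_eq]
  simp only [← sq]
  exact Finset.sum_le_sum_of_subset_of_nonneg (Finset.subset_univ S) fun i _ _ => sq_nonneg _

theorem continuous_regularizer (G : Fin g → Finset (Fin n)) (w : Fin g → ℝ) (lam1 lam2 : ℝ) :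
    Continuous (regularizer G w lam1 lam2) := by
  have := fun l => continuous_restrict (G l)
  unfold regularizer
  fun_prop

theorem regularizer_smul (G : Fin g → Finset (Fin n)) (w : Fin g → ℝ) (lam1 lam2 : ℝ) {c : ℝ}
    (hc : 0 ≤ c) (x : EuclideanSpace ℝ (Fin n)) :
    regularizer G w lam1 lam2 (c • x) = c * regularizer G w lam1 lam2 x := by
  simp only [regularizer, restrict_smul, norm_smul, PiLp.smul_apply, smul_eq_mul, abs_mul,
    Real.norm_eq_abs, abs_of_nonneg hc, mul_add, Finset.mul_sum]
  congr 1 <;> exact Finset.sum_congr rfl fun _ _ => by ring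

theorem regularizer_add_le (G : Fin g → Finset (Fin n)) {w : Fin g → ℝ} (hw : ∀ l, 0 < w l)
    {lam1 lam2 : ℝ} (hlam1 : 0 ≤ lam1) (hlam2 : 0 ≤ lam2) (x y : EuclideanSpace ℝ (Fin n)) :
    regularizer G w lam1 lam2 (x + y) ≤
      regularizer G w lam1 lam2 x + regularizer G w lam1 lam2 y := by
  have h1 : ∑ i, |(x + y) i| ≤ ∑ i, |x i| + ∑ i, |y i| := by
    rw [← Finset.sum_add_distrib]
    exact Finset.sum_le_sum fun i _ => abs_add_le _ _
  have h2 : ∑ l, w l * ‖restrict (G l) (x + y)‖ ≤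
      ∑ l, w l * ‖restrict (G l) x‖ + ∑ l, w l * ‖restrict (G l) y‖ := by
    rw [← Finset.sum_add_distrib]
    refine Finset.sum_le_sum fun l _ => ?_
    rw [restrict_add, ← mul_add]
    exact mul_le_mul_of_nonneg_left (norm_add_le _ _) (hw l).le
  have := mul_le_mul_of_nonneg_left h1 hlam1
  have := mul_le_mul_of_nonneg_left h2 hlam2
  unfold regularizer
  linarith

/-- Without the group terms, the regularizer is that of the partition into singletons without the
`ℓ¹` term. -/
theorem regularizer_zero_right (G : Fin g → Finset (Fin n)) (w : Fin g → ℝ) (lam1 : ℝ) :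
    regularizer G w lam1 0 = regularizer (fun i : Fin n => {i}) (fun _ => 1) 0 lam1 := by
  funext x
  have h : ∀ i : Fin n, ‖restrict {i} x‖ = |x i| := fun i => by
    rw [← sq_eq_sq₀ (norm_nonneg _) (abs_nonneg _), ← real_inner_self_eq_norm_sq, inner_restrict]
    simp [sq]
  simp [regularizer, h]

-- A partition is given by the sets `G l` together with the map `π` sending an index to its group.
variable {G : Fin g → Finset (Fin n)} {π : Fin n → Fin g}

theorem sum_sum_group (hπ : ∀ i l, i ∈ G l ↔ π i = l) (f : Fin n → ℝ) :
    ∑ l, ∑ i ∈ G l, f i = ∑ i, f i := by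
  have hG : ∀ l, G l = Finset.univ.filter fun i => π i = l := fun l => by
    ext i
    simp [hπ]
  simp only [hG]
  exact Finset.sum_fiberwise _ _ _

theorem sum_inner_restrict (hπ : ∀ i l, i ∈ G l ↔ π i = l) (x y : EuclideanSpace ℝ (Fin n)) :
    ∑ l, inner ℝ (restrict (G l) x) (restrict (G l) y) = inner ℝ x y := by
  simp only [inner_restrict, sum_sum_group hπ fun i => x i * y i]
  simp [PiLp.inner_apply, mul_comm]

theorem sum_norm_restrict_sq (hπ : ∀ i l, i ∈ G l ↔ π i = l) (x : EuclideanSpace ℝ (Fin n)) :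
    ∑ l, ‖restrict (G l) x‖ ^ 2 = ‖x‖ ^ 2 := by
  simp only [← real_inner_self_eq_norm_sq]
  exact sum_inner_restrict hπ x x

theorem regularizer_sub_inner_add (hπ : ∀ i l, i ∈ G l ↔ π i = l) (w : Fin g → ℝ)
    (lam1 lam2 : ℝ) (a s x : EuclideanSpace ℝ (Fin n)) :
    regularizer G w lam1 lam2 x - inner ℝ (a + s) x =
      ∑ i, (lam1 * |x i| - a i * x i) +
      ∑ l, (lam2 * w l * ‖restrict (G l) x‖ - inner ℝ (restrict (G l) s) (restrict (G l) x)) := by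
  have ha : inner ℝ a x = ∑ i, a i * x i := by simp [PiLp.inner_apply, mul_comm]
  rw [Finset.sum_sub_distrib, Finset.sum_sub_distrib, sum_inner_restrict hπ, inner_add_left, ha,
    regularizer, Finset.mul_sum, Finset.mul_sum]
  simp only [mul_assoc]
  ring

theorem mul_le_mul_abs_of_abs_le {a c x : ℝ} (h : |a| ≤ c) : a * x ≤ c * |x| :=
  calc a * x ≤ |a * x| := le_abs_self _
    _ = |a| * |x| := abs_mul _ _
    _ ≤ c * |x| := mul_le_mul_of_nonneg_right h (abs_nonneg _)

theorem sum_le_regularizer_sub_inner_add (hπ : ∀ i l, i ∈ G l ↔ π i = l) (w : Fin g → ℝ)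
    {lam1 : ℝ} (lam2 : ℝ) {a : EuclideanSpace ℝ (Fin n)} (ha : ∀ i, |a i| ≤ lam1)
    (s x : EuclideanSpace ℝ (Fin n)) :
    ∑ l, (lam2 * w l * ‖restrict (G l) x‖ - inner ℝ (restrict (G l) s) (restrict (G l) x)) ≤
      regularizer G w lam1 lam2 x - inner ℝ (a + s) x := by
  rw [regularizer_sub_inner_add hπ]
  have : 0 ≤ ∑ i, (lam1 * |x i| - a i * x i) :=
    Finset.sum_nonneg fun i _ => sub_nonneg.2 (mul_le_mul_abs_of_abs_le (ha i))
  linarith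

/-- The subgradient is assembled from the signs of the coordinates of `x` and its normalized group
restrictions; division by a vanishing group norm yields the subgradient `0` there. -/
theorem subdifferential_regularizer_nonempty (hπ : ∀ i l, i ∈ G l ↔ π i = l) {w : Fin g → ℝ}
    (hw : ∀ l, 0 < w l) {lam1 lam2 : ℝ} (hlam1 : 0 ≤ lam1) (hlam2 : 0 ≤ lam2)
    (x : EuclideanSpace ℝ (Fin n)) :
    (subdifferential (regularizer G w lam1 lam2) x).Nonempty := by
  let a : EuclideanSpace ℝ (Fin n) := WithLp.toLp 2 fun i => lam1 * (SignType.sign (x i) : ℝ)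
  let s : EuclideanSpace ℝ (Fin n) :=
    WithLp.toLp 2 fun i => lam2 * w (π i) / ‖restrict (G (π i)) x‖ * x i
  have hs : ∀ l, restrict (G l) s = (lam2 * w l / ‖restrict (G l) x‖) • restrict (G l) x := by
    intro l
    ext ⟨i, hi⟩
    obtain rfl := (hπ i l).1 hi
    simp [restrict_apply, s]
  have ha : ∀ i, |a i| ≤ lam1 := fun i => by
    simp only [a, abs_mul, abs_of_nonneg hlam1]
    refine mul_le_of_le_one_right hlam1 ?_
    rcases lt_trichotomy (x i) 0 with h | h | h <;> simp [h]
  have hsle : ∀ l, ‖restrict (G l) s‖ ≤ lam2 * w l := by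
    intro l
    have h0 : 0 ≤ lam2 * w l := mul_nonneg hlam2 (hw l).le
    rw [hs, norm_smul, norm_div, norm_norm, Real.norm_of_nonneg h0]
    rcases eq_or_ne ‖restrict (G l) x‖ 0 with h | h
    · simpa [h] using h0
    · rw [div_mul_cancel₀ _ h]
  have hx : regularizer G w lam1 lam2 x - inner ℝ (a + s) x = 0 := by
    rw [regularizer_sub_inner_add hπ, Finset.sum_eq_zero, Finset.sum_eq_zero, add_zero]
    · intro l _
      rw [hs, inner_smul_left, real_inner_self_eq_norm_sq]
      rcases eq_or_ne ‖restrict (G l) x‖ 0 with h | h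
      · simp [h]
      · simp
        field_simp
        ring
    · intro i _
      simp only [a, mul_assoc, sign_mul_self, sub_self]
  refine ⟨a + s, fun y => ?_⟩
  have hy := sum_le_regularizer_sub_inner_add hπ w lam2 ha s y
  have : 0 ≤ ∑ l, (lam2 * w l * ‖restrict (G l) y‖ -
      inner ℝ (restrict (G l) s) (restrict (G l) y)) :=
    Finset.sum_nonneg fun l _ => sub_nonneg.2 ((real_inner_le_norm _ _).trans
      (mul_le_mul_of_nonneg_right (hsle l) (norm_nonneg _)))
  rw [inner_sub_right]
  linarith

/-- A linear form dominated by the regularizer splits into one dominated by the `ℓ¹` term and one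
dominated by the group terms. The splitting is by soft thresholding: `a` is `u` truncated to
`[-lam1, lam1]` and `s` is the excess. -/
theorem exists_add_eq_of_inner_le_regularizer (hπ : ∀ i l, i ∈ G l ↔ π i = l) {w : Fin g → ℝ}
    (hw : ∀ l, 0 < w l) {lam1 lam2 : ℝ} (hlam1 : 0 ≤ lam1) (hlam2 : 0 ≤ lam2)
    {u : EuclideanSpace ℝ (Fin n)} (hu : ∀ y, inner ℝ u y ≤ regularizer G w lam1 lam2 y) :
    ∃ a s : EuclideanSpace ℝ (Fin n), a + s = u ∧ (∀ i, |a i| ≤ lam1) ∧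
      (∀ i, a i * s i = lam1 * |s i|) ∧ ∀ l, ‖restrict (G l) s‖ ≤ lam2 * w l := by
  let a : EuclideanSpace ℝ (Fin n) := WithLp.toLp 2 fun i => max (-lam1) (min lam1 (u i))
  have hai : ∀ i, a i = max (-lam1) (min lam1 (u i)) := fun _ => rfl
  have hale : ∀ i, |a i| ≤ lam1 := fun i => by
    rw [hai, abs_le]
    exact ⟨le_max_left _ _, max_le (by linarith) (min_le_left _ _)⟩
  have has : ∀ i, a i * (u - a) i = lam1 * |(u - a) i| := by
    intro i
    rw [PiLp.sub_apply, hai]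
    rcases le_total lam1 (u i) with h1 | h1
    · rw [min_eq_left h1, max_eq_right (by linarith), abs_of_nonneg (by linarith)]
    · rw [min_eq_right h1]
      rcases le_total (u i) (-lam1) with h2 | h2
      · rw [max_eq_left h2, abs_of_nonpos (by linarith)]
        ring
      · rw [max_eq_right h2]
        simp
  refine ⟨a, u - a, by abel, hale, has, fun l => ?_⟩
  set s := u - a
  -- Test the domination on the part of `s` supported in the group `l`.
  let y : EuclideanSpace ℝ (Fin n) := WithLp.toLp 2 fun i => if π i = l then s i else 0
  have hyl : restrict (G l) y = restrict (G l) s := by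
    ext ⟨i, hi⟩
    simp [restrict_apply, y, (hπ i l).1 hi]
  have hyk : ∀ k, k ≠ l → restrict (G k) y = 0 := by
    intro k hk
    ext ⟨i, hi⟩
    simp [restrict_apply, y, (hπ i k).1 hi, hk]
  have hgap := hu y
  have hexp := regularizer_sub_inner_add hπ w lam1 lam2 a s y
  rw [show a + s = u by simp [s], Finset.sum_eq_zero (fun i _ => ?_),
    Finset.sum_eq_single l (fun k _ hk => ?_) (by simp)] at hexp
  · rw [hyl, real_inner_self_eq_norm_sq] at hexp
    by_contra! hlt
    have hpos : 0 < ‖restrict (G l) s‖ :=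
      (mul_nonneg hlam2 (hw l).le).trans_lt hlt
    nlinarith
  · rw [hyk k hk]
    simp
  · by_cases h : π i = l
    · simp [y, h, has i]
    · simp [y, h]

/-- The exposed face `{x | p x = ⟪u, x⟫}` of the regularizer `p` is a simplicial cone `L t`,
`0 ≤ t`: a group contributes a ray if the excess of `u` there has the maximal norm
`lam2 * w l`, and nothing otherwise. The gap `p x - ⟪u, x⟫` grows quadratically away from it. -/
theorem exists_face_parametrization (hπ : ∀ i l, i ∈ G l ↔ π i = l) {w : Fin g → ℝ}
    (hw : ∀ l, 0 < w l) {lam1 lam2 : ℝ} (hlam1 : 0 ≤ lam1) (hlam2 : 0 < lam2)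
    {u : EuclideanSpace ℝ (Fin n)} (hu : ∀ y, inner ℝ u y ≤ regularizer G w lam1 lam2 y) :
    ∃ L : (Fin g → ℝ) →ₗ[ℝ] EuclideanSpace ℝ (Fin n),
      (∀ t, 0 ≤ t → regularizer G w lam1 lam2 (L t) = inner ℝ u (L t)) ∧
      ∀ R : ℝ, 0 ≤ R → ∃ C : ℝ, 0 ≤ C ∧ ∀ x, ‖x‖ ≤ R → ∃ t, 0 ≤ t ∧
        ‖x - L t‖ ^ 2 ≤ C * (regularizer G w lam1 lam2 x - inner ℝ u x) := by
  classical
  obtain ⟨a, s, rfl, ha, has, hs⟩ := exists_add_eq_of_inner_le_regularizer hπ hw hlam1 hlam2.le hu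
  let d : Fin n → ℝ := fun i => if ‖restrict (G (π i)) s‖ = lam2 * w (π i) then s i else 0
  let L : (Fin g → ℝ) →ₗ[ℝ] EuclideanSpace ℝ (Fin n) :=
    { toFun := fun t => WithLp.toLp 2 fun i => t (π i) * d i
      map_add' := fun t t' => by
        ext i
        simp [add_mul]
      map_smul' := fun c t => by
        ext i
        simp [mul_assoc] }
  have hLi : ∀ t i, L t i = t (π i) * d i := fun _ _ => rfl
  have hLr : ∀ t l, restrict (G l) (L t) =
      t l • (if ‖restrict (G l) s‖ = lam2 * w l then restrict (G l) s else 0) := by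
    intro t l
    ext ⟨i, hi⟩
    obtain rfl := (hπ i l).1 hi
    by_cases h : ‖restrict (G (π i)) s‖ = lam2 * w (π i)
    · simp [restrict_apply, hLi, d, h]
    · simp [restrict_apply, hLi, d, h]
  refine ⟨L, fun t ht => ?_, fun R hR => ?_⟩
  · rw [← sub_eq_zero, regularizer_sub_inner_add hπ, Finset.sum_eq_zero, Finset.sum_eq_zero,
      add_zero]
    · intro l _
      rw [hLr]
      split_ifs with h
      · rw [norm_smul, inner_smul_right, real_inner_self_eq_norm_sq, Real.norm_of_nonneg (ht l), h]
        ring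
      · simp
    · intro i _
      rw [hLi, abs_mul, abs_of_nonneg (ht (π i))]
      by_cases h : ‖restrict (G (π i)) s‖ = lam2 * w (π i)
      · simp only [d, if_pos h]
        linear_combination -(t (π i)) * has i
      · simp [d, h]
  · choose C hC hgrowth using fun l =>
      exists_norm_sub_ray_sq_le (restrict (G l) s) (mul_pos hlam2 (hw l)) (hs l) hR
    refine ⟨∑ l, C l, Finset.sum_nonneg fun l _ => hC l, fun x hx => ?_⟩
    choose t ht htx using fun l => hgrowth l (restrict (G l) x) ((norm_restrict_le _ _).trans hx)
    have hgap : ∀ l, 0 ≤ lam2 * w l * ‖restrict (G l) x‖ -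
        inner ℝ (restrict (G l) s) (restrict (G l) x) := fun l =>
      sub_nonneg.2 ((real_inner_le_norm _ _).trans
        (mul_le_mul_of_nonneg_right (hs l) (norm_nonneg _)))
    refine ⟨t, ht, ?_⟩
    calc ‖x - L t‖ ^ 2 = ∑ l, ‖restrict (G l) (x - L t)‖ ^ 2 := (sum_norm_restrict_sq hπ _).symm
      _ ≤ ∑ l, (∑ k, C k) * (lam2 * w l * ‖restrict (G l) x‖ -
          inner ℝ (restrict (G l) s) (restrict (G l) x)) := by
        refine Finset.sum_le_sum fun l _ => ?_
        rw [restrict_sub, hLr]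
        exact (htx l).trans (mul_le_mul_of_nonneg_right
          (Finset.single_le_sum (fun k _ => hC k) (Finset.mem_univ l)) (hgap l))
      _ ≤ (∑ l, C l) * (regularizer G w lam1 lam2 x - inner ℝ (a + s) x) := by
        rw [← Finset.mul_sum]
        exact mul_le_mul_of_nonneg_left (sum_le_regularizer_sub_inner_add hπ w lam2 ha s x)
          (Finset.sum_nonneg fun l _ => hC l)

theorem exists_norm_le_mul_regularizer (hπ : ∀ i l, i ∈ G l ↔ π i = l) {w : Fin g → ℝ}
    (hw : ∀ l, 0 < w l) {lam1 lam2 : ℝ} (hlam1 : 0 ≤ lam1) (hlam2 : 0 < lam2) :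
    ∃ C : ℝ, 0 ≤ C ∧ ∀ x, ‖x‖ ≤ C * regularizer G w lam1 lam2 x := by
  have hc : ∀ l, 0 < lam2 * w l := fun l => mul_pos hlam2 (hw l)
  have hC : ∀ l, 0 ≤ (lam2 * w l)⁻¹ := fun l => (inv_pos.2 (hc l)).le
  refine ⟨∑ l, (lam2 * w l)⁻¹, Finset.sum_nonneg fun l _ => hC l, fun x => ?_⟩
  have hp : ∀ l, ‖restrict (G l) x‖ ≤ (lam2 * w l)⁻¹ * regularizer G w lam1 lam2 x := by
    intro l
    rw [inv_mul_eq_div, le_div_iff₀ (hc l)]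
    have h1 : 0 ≤ lam1 * ∑ i, |x i| :=
      mul_nonneg hlam1 (Finset.sum_nonneg fun i _ => abs_nonneg _)
    have h2 : w l * ‖restrict (G l) x‖ ≤ ∑ k, w k * ‖restrict (G k) x‖ :=
      Finset.single_le_sum (f := fun k => w k * ‖restrict (G k) x‖)
        (fun k _ => mul_nonneg (hw k).le (norm_nonneg _)) (Finset.mem_univ l)
    have h3 := mul_le_mul_of_nonneg_left h2 hlam2.le
    unfold regularizer
    linarith
  calc ‖x‖ ≤ ∑ l, ‖restrict (G l) x‖ := by
        refine le_of_sq_le_sq ?_ (Finset.sum_nonneg fun l _ => norm_nonneg _)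
        rw [← sum_norm_restrict_sq hπ]
        exact Finset.sum_sq_le_sq_sum_of_nonneg fun l _ => norm_nonneg _
    _ ≤ ∑ l, (lam2 * w l)⁻¹ * regularizer G w lam1 lam2 x := Finset.sum_le_sum fun l _ => hp l
    _ = _ := (Finset.sum_mul _ _ _).symm

end Regularizer

/-! ### The error bound -/

section ErrorBound

variable {n m g : ℕ} {A : EuclideanSpace ℝ (Fin n) →ₗ[ℝ] EuclideanSpace ℝ (Fin m)}
  {b : EuclideanSpace ℝ (Fin m)} {G : Fin g → Finset (Fin n)} {π : Fin n → Fin g} {w : Fin g → ℝ}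
  {lam1 lam2 : ℝ}

theorem isClosed_solutionSet : IsClosed (solutionSet A b G w lam1 lam2) := by
  have hF := (continuous_loss A b).add (continuous_regularizer G w lam1 lam2)
  have h : solutionSet A b G w lam1 lam2 = ⋂ y, {x | loss A b x + regularizer G w lam1 lam2 x ≤
      loss A b y + regularizer G w lam1 lam2 y} := by
    ext x
    simp [solutionSet, minimizers]
  rw [h]
  exact isClosed_iInter fun y => isClosed_le hF continuous_const

theorem exists_norm_le_of_objective_le (hπ : ∀ i l, i ∈ G l ↔ π i = l) (hw : ∀ l, 0 < w l)
    (hlam1 : 0 ≤ lam1) (hlam2 : 0 < lam2) (c : ℝ) :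
    ∃ M : ℝ, ∀ x, loss A b x + regularizer G w lam1 lam2 x ≤ c → ‖x‖ ≤ M := by
  obtain ⟨C, hC, h⟩ := exists_norm_le_mul_regularizer hπ hw hlam1 hlam2
  refine ⟨C * c, fun x hx => (h x).trans (mul_le_mul_of_nonneg_left ?_ hC)⟩
  have : 0 ≤ loss A b x := by unfold loss; positivity
  linarith

theorem solutionSet_nonempty (hπ : ∀ i l, i ∈ G l ↔ π i = l) (hw : ∀ l, 0 < w l)
    (hlam1 : 0 ≤ lam1) (hlam2 : 0 < lam2) : (solutionSet A b G w lam1 lam2).Nonempty := by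
  have hF := (continuous_loss A b).add (continuous_regularizer G w lam1 lam2)
  obtain ⟨M, hM⟩ := exists_norm_le_of_objective_le (A := A) (b := b) hπ hw hlam1 hlam2
    (loss A b 0 + regularizer G w lam1 lam2 0)
  obtain ⟨x, hx⟩ := hF.exists_forall_le' 0 (by
    filter_upwards [(isCompact_closedBall (0 : EuclideanSpace ℝ (Fin n)) M).compl_mem_cocompact]
      with x hx
    by_contra! h
    exact hx (mem_closedBall_zero_iff.2 (hM x h.le)))
  exact ⟨x, hx⟩

/-- Fermat's rule, combined with the positive homogeneity of the regularizer. -/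
theorem inner_neg_gradient_of_mem_solutionSet (hw : ∀ l, 0 < w l) (hlam1 : 0 ≤ lam1)
    (hlam2 : 0 ≤ lam2) {x : EuclideanSpace ℝ (Fin n)} (hx : x ∈ solutionSet A b G w lam1 lam2) :
    inner ℝ (-gradient (loss A b) x) x = regularizer G w lam1 lam2 x ∧
      ∀ y, inner ℝ (-gradient (loss A b) x) y ≤ regularizer G w lam1 lam2 y := by
  -- If `t * e + t ^ 2 * q` is nonnegative on `(0, 1]`, so is its slope `e` at `0`.
  have hlim : ∀ e q : ℝ, (∀ t : ℝ, 0 < t → t ≤ 1 → 0 ≤ t * e + t ^ 2 * q) → 0 ≤ e := by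
    intro e q h
    by_contra! he
    have ht : 0 < min 1 (-e / (2 * (|q| + 1))) := lt_min one_pos (by
      have := abs_nonneg q
      apply div_pos <;> linarith)
    set t := min 1 (-e / (2 * (|q| + 1)))
    have h1 := h t ht (min_le_left _ _)
    have h2 : t ≤ -e / (2 * (|q| + 1)) := min_le_right _ _
    rw [le_div_iff₀ (by positivity)] at h2
    have h3 : 0 ≤ e + t * q := by
      by_contra! h4
      nlinarith [mul_pos_of_neg_of_neg h4 (neg_neg_of_pos ht)]
    nlinarith [mul_le_mul_of_nonneg_left (le_abs_self q) ht.le]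
  -- Moving in the direction of any `y` shows the domination.
  have hle : ∀ y, inner ℝ (-gradient (loss A b) x) y ≤ regularizer G w lam1 lam2 y := by
    intro y
    have := hlim (inner ℝ (gradient (loss A b) x) y + regularizer G w lam1 lam2 y)
      (1 / 2 * ‖A y‖ ^ 2) fun t ht _ => by
        have h1 := hx (x + t • y)
        simp only [loss_eq_add_inner_gradient A b x (x + t • y), add_sub_cancel_left,
          inner_smul_right, map_smul, norm_smul, Real.norm_of_nonneg ht.le] at h1
        have h2 := regularizer_add_le G hw hlam1 hlam2 x (t • y)
        rw [regularizer_smul G w lam1 lam2 ht.le] at h2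
        linarith [mul_pow t ‖A y‖ 2]
    rw [inner_neg_left]
    linarith
  refine ⟨(hle x).antisymm ?_, hle⟩
  -- Shrinking `x` towards the origin gives the reverse inequality at `x` itself.
  have := hlim (-inner ℝ (gradient (loss A b) x) x - regularizer G w lam1 lam2 x)
    (1 / 2 * ‖A x‖ ^ 2) fun t ht ht1 => by
      have h1 := hx ((1 - t) • x)
      simp only [loss_eq_add_inner_gradient A b x ((1 - t) • x),
        regularizer_smul G w lam1 lam2 (sub_nonneg.2 ht1),
        show (1 - t) • x - x = (-t) • x by module, inner_smul_right, map_smul, norm_smul,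
        Real.norm_eq_abs, abs_neg, abs_of_pos ht] at h1
      linarith [mul_pow t ‖A x‖ 2]
  rw [inner_neg_left]
  linarith

/-- At a minimizer `x`, the excess of the objective at `y` is a quadratic residual of `A y = A x`
plus the gap of the regularizer above the linear form `-∇f(x)`. -/
theorem objective_sub_eq {x : EuclideanSpace ℝ (Fin n)}
    (hx : inner ℝ (-gradient (loss A b) x) x = regularizer G w lam1 lam2 x)
    (y : EuclideanSpace ℝ (Fin n)) :
    loss A b y + regularizer G w lam1 lam2 y - (loss A b x + regularizer G w lam1 lam2 x) =
      1 / 2 * ‖A y - A x‖ ^ 2 +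
        (regularizer G w lam1 lam2 y - inner ℝ (-gradient (loss A b) x) y) := by
  rw [loss_eq_add_inner_gradient A b x y, ← hx, inner_sub_right, map_sub, inner_neg_left,
    inner_neg_left]
  ring

/-- Quadratic growth of the objective on bounded sets. -/
theorem exists_infDist_sq_le_mul_objective_sub (hπ : ∀ i l, i ∈ G l ↔ π i = l)
    (hw : ∀ l, 0 < w l) (hlam1 : 0 ≤ lam1) (hlam2 : 0 < lam2) {x₀ : EuclideanSpace ℝ (Fin n)}
    (hx₀ : x₀ ∈ solutionSet A b G w lam1 lam2) {R : ℝ} (hR : 0 ≤ R) :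
    ∃ C : ℝ, 0 ≤ C ∧ ∀ x, ‖x‖ ≤ R →
      Metric.infDist x (solutionSet A b G w lam1 lam2) ^ 2 ≤
        C * (loss A b x + regularizer G w lam1 lam2 x -
          (loss A b x₀ + regularizer G w lam1 lam2 x₀)) := by
  obtain ⟨heq, hle⟩ := inner_neg_gradient_of_mem_solutionSet hw hlam1 hlam2.le hx₀
  obtain ⟨L, hL, hgrowth⟩ := exists_face_parametrization hπ hw hlam1 hlam2 hle
  obtain ⟨C, hC, hCx⟩ := hgrowth R hR
  obtain ⟨H, hH, hHoff⟩ := exists_nonneg_solution_norm_sub_le (A ∘ₗ L)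
  -- The minimizer `x₀` has zero gap, so it lies on the face.
  obtain ⟨t₀, ht₀, hLt₀⟩ : ∃ t₀, 0 ≤ t₀ ∧ L t₀ = x₀ := by
    obtain ⟨C₀, -, h₀⟩ := hgrowth ‖x₀‖ (norm_nonneg _)
    obtain ⟨t, ht, h⟩ := h₀ x₀ le_rfl
    rw [heq, sub_self, mul_zero] at h
    refine ⟨t, ht, ?_⟩
    have : ‖x₀ - L t‖ = 0 := pow_eq_zero_iff two_ne_zero |>.1 (h.antisymm (sq_nonneg _))
    exact (sub_eq_zero.1 (norm_eq_zero.1 this)).symm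
  set A' := A.toContinuousLinearMap
  set L' := L.toContinuousLinearMap
  have hA : ∀ z, ‖A z‖ ≤ ‖A'‖ * ‖z‖ := A'.le_opNorm
  have hLn : ∀ z, ‖L z‖ ≤ ‖L'‖ * ‖z‖ := L'.le_opNorm
  refine ⟨2 * (1 + ‖L'‖ * H * ‖A'‖) ^ 2 * C + 4 * (‖L'‖ * H) ^ 2, by positivity, fun x hx => ?_⟩
  have hq := objective_sub_eq heq x
  set q := loss A b x + regularizer G w lam1 lam2 x -
    (loss A b x₀ + regularizer G w lam1 lam2 x₀)
  have hgap := sub_nonneg.2 (hle x)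
  obtain ⟨t, ht, htx⟩ := hCx x hx
  obtain ⟨s, hs, hsA, hts⟩ := hHoff t t₀ ht ht₀
  simp only [LinearMap.comp_apply, hLt₀] at hsA hts
  have hmem : L s ∈ solutionSet A b G w lam1 lam2 := by
    have h := objective_sub_eq heq (L s)
    rw [hsA, ← hL s hs, sub_self, sub_self, norm_zero] at h
    intro y
    have := hx₀ y
    dsimp only at this ⊢
    linarith
  have h1 : ‖A (L t) - A x₀‖ ≤ ‖A'‖ * ‖x - L t‖ + ‖A x - A x₀‖ := by
    have h2 := norm_sub_le_norm_sub_add_norm_sub (A (L t)) (A x) (A x₀)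
    have h3 := hA (x - L t)
    rw [map_sub, norm_sub_rev] at h3
    linarith
  have h2 : ‖L t - L s‖ ≤ ‖L'‖ * H * (‖A'‖ * ‖x - L t‖ + ‖A x - A x₀‖) := by
    rw [← map_sub, mul_assoc]
    exact (hLn _).trans (mul_le_mul_of_nonneg_left
      (hts.trans (mul_le_mul_of_nonneg_left h1 hH)) (norm_nonneg _))
  have h3 : Metric.infDist x (solutionSet A b G w lam1 lam2) ≤
      (1 + ‖L'‖ * H * ‖A'‖) * ‖x - L t‖ + ‖L'‖ * H * ‖A x - A x₀‖ := by
    have h4 := Metric.infDist_le_dist_of_mem (x := x) hmem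
    rw [dist_eq_norm] at h4
    linarith [norm_sub_le_norm_sub_add_norm_sub x (L t) (L s)]
  set α := 1 + ‖L'‖ * H * ‖A'‖
  set β := ‖L'‖ * H
  calc Metric.infDist x (solutionSet A b G w lam1 lam2) ^ 2
      ≤ (α * ‖x - L t‖ + β * ‖A x - A x₀‖) ^ 2 := pow_le_pow_left₀ Metric.infDist_nonneg h3 2
    _ ≤ 2 * α ^ 2 * ‖x - L t‖ ^ 2 + 2 * β ^ 2 * ‖A x - A x₀‖ ^ 2 := by
      linarith [sq_nonneg (α * ‖x - L t‖ - β * ‖A x - A x₀‖)]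
    _ ≤ 2 * α ^ 2 * (C * q) + 2 * β ^ 2 * (2 * q) := by
      have h5 : 0 ≤ 1 / 2 * ‖A x - A x₀‖ ^ 2 := by positivity
      have h6 : ‖x - L t‖ ^ 2 ≤ C * q :=
        htx.trans (mul_le_mul_of_nonneg_left (by linarith) hC)
      have h7 : ‖A x - A x₀‖ ^ 2 ≤ 2 * q := by linarith
      gcongr
    _ = (2 * α ^ 2 * C + 4 * β ^ 2) * q := by ring

theorem objective_sub_le_inner {x v y : EuclideanSpace ℝ (Fin n)}
    (hv : v ∈ optimalityMap A b G w lam1 lam2 x) :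
    loss A b x + regularizer G w lam1 lam2 x - (loss A b y + regularizer G w lam1 lam2 y) ≤
      inner ℝ v (x - y) := by
  obtain ⟨u, hu, rfl⟩ := hv
  have h1 := hu y
  have h2 := loss_eq_add_inner_gradient A b x y
  have h3 : 0 ≤ 1 / 2 * ‖A (y - x)‖ ^ 2 := by positivity
  rw [← neg_sub y x, inner_neg_right, inner_add_left]
  linarith

theorem optimalityMap_nonempty (hπ : ∀ i l, i ∈ G l ↔ π i = l) (hw : ∀ l, 0 < w l)
    (hlam1 : 0 ≤ lam1) (hlam2 : 0 ≤ lam2) (x : EuclideanSpace ℝ (Fin n)) :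
    (optimalityMap A b G w lam1 lam2 x).Nonempty := by
  obtain ⟨u, hu⟩ := subdifferential_regularizer_nonempty hπ hw hlam1 hlam2 x
  exact ⟨_, u, hu, rfl⟩

/-- The error bound when the group terms are present. For `v ∈ T(x)` and `d` the distance of `x` to
the solution set, quadratic growth and convexity give `d ^ 2 ≤ C * (F x - min F) ≤ C * ‖v‖ * d`. -/
theorem exists_infDist_solutionSet_le (hπ : ∀ i l, i ∈ G l ↔ π i = l) (hw : ∀ l, 0 < w l)
    (hlam1 : 0 ≤ lam1) (hlam2 : 0 < lam2) {r : ℝ} (hr : 0 < r) :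
    ∃ κ : ℝ, 0 < κ ∧ ∀ x : EuclideanSpace ℝ (Fin n),
      Metric.infDist x (solutionSet A b G w lam1 lam2) ≤ r →
        Metric.infDist x (solutionSet A b G w lam1 lam2) ≤
          κ * Metric.infDist 0 (optimalityMap A b G w lam1 lam2 x) := by
  -- The points `x` in question form a bounded set, because the solution set is bounded.
  obtain ⟨x₀, hx₀⟩ := solutionSet_nonempty (A := A) (b := b) hπ hw hlam1 hlam2
  obtain ⟨M, hM⟩ := exists_norm_le_of_objective_le (A := A) (b := b) hπ hw hlam1 hlam2
    (loss A b x₀ + regularizer G w lam1 lam2 x₀)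
  have hM0 : 0 ≤ M := (norm_nonneg x₀).trans (hM x₀ le_rfl)
  obtain ⟨C, hC, hgrowth⟩ := exists_infDist_sq_le_mul_objective_sub hπ hw hlam1 hlam2 hx₀
    (R := r + M) (by linarith)
  refine ⟨C + 1, by linarith, fun x hx => ?_⟩
  obtain ⟨y, hy, hxy⟩ := (isClosed_solutionSet (A := A) (b := b) (G := G) (w := w) (lam1 := lam1)
    (lam2 := lam2)).exists_infDist_eq_dist ⟨x₀, hx₀⟩ x
  rw [dist_eq_norm] at hxy
  set d := Metric.infDist x (solutionSet A b G w lam1 lam2)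
  have hd : 0 ≤ d := Metric.infDist_nonneg
  have hxR : ‖x‖ ≤ r + M := by
    have := norm_le_norm_sub_add x y
    linarith [hM y (hy x₀)]
  have hbound : ∀ v ∈ optimalityMap A b G w lam1 lam2 x, d ≤ (C + 1) * ‖v‖ := by
    intro v hv
    have h1 := (objective_sub_le_inner (y := y) hv).trans (real_inner_le_norm _ _)
    rw [← hxy] at h1
    have h2 : loss A b y + regularizer G w lam1 lam2 y ≤
        loss A b x₀ + regularizer G w lam1 lam2 x₀ := hy x₀
    have h3 : d ^ 2 ≤ C * (‖v‖ * d) :=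
      (hgrowth x hxR).trans (mul_le_mul_of_nonneg_left (by linarith) hC)
    rcases hd.eq_or_lt with h | h
    · rw [← h]
      positivity
    · have h4 : d ≤ C * ‖v‖ := le_of_mul_le_mul_right (by linarith [sq d]) h
      linarith [norm_nonneg v]
  have hne := optimalityMap_nonempty (A := A) (b := b) hπ hw hlam1 hlam2.le x
  rw [← div_le_iff₀' (by linarith), Metric.le_infDist hne]
  intro v hv
  rw [dist_zero_left, div_le_iff₀' (by linarith)]
  exact hbound v hv

end ErrorBound

end SGLasso

theorem proposition2p2 {n m g : ℕ}
    (A : EuclideanSpace ℝ (Fin n) →ₗ[ℝ] EuclideanSpace ℝ (Fin m))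
    (b : EuclideanSpace ℝ (Fin m))
    (G : Fin g → Finset (Fin n))
    (hG_disj : ∀ i j : Fin g, i < j → Disjoint (G i) (G j))
    (hG_cover : ∀ k : Fin n, ∃ l : Fin g, k ∈ G l)
    (w : Fin g → ℝ) (hw : ∀ l, 0 < w l)
    (lam1 lam2 : ℝ) (hlam1 : 0 ≤ lam1) (hlam2 : 0 ≤ lam2) (hlam : 0 < lam1 + lam2) :
    (SGLasso.solutionSet A b G w lam1 lam2).Nonempty ∧
    ∀ r : ℝ, 0 < r → ∃ κ : ℝ, 0 < κ ∧ ∀ x : EuclideanSpace ℝ (Fin n),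
      Metric.infDist x (SGLasso.solutionSet A b G w lam1 lam2) ≤ r →
        (SGLasso.optimalityMap A b G w lam1 lam2 x).Nonempty ∧
        Metric.infDist x (SGLasso.solutionSet A b G w lam1 lam2) ≤
          κ * Metric.infDist 0 (SGLasso.optimalityMap A b G w lam1 lam2 x) := by
  rcases hlam2.eq_or_lt with rfl | hpos
  · have hlam1 : 0 < lam1 := by linarith
    have hπ : ∀ i l : Fin n, i ∈ ({l} : Finset (Fin n)) ↔ id i = l := by simp
    simp only [SGLasso.solutionSet, SGLasso.optimalityMap, SGLasso.regularizer_zero_right]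
    refine ⟨SGLasso.solutionSet_nonempty hπ (fun _ => one_pos) le_rfl hlam1, fun r hr => ?_⟩
    obtain ⟨κ, hκ, h⟩ := SGLasso.exists_infDist_solutionSet_le (A := A) (b := b) hπ
      (fun _ => one_pos) le_rfl hlam1 hr
    exact ⟨κ, hκ, fun x hx => ⟨SGLasso.optimalityMap_nonempty hπ (fun _ => one_pos) le_rfl
      hlam1.le x, h x hx⟩⟩
  · choose π hπmem using hG_cover
    have hπ : ∀ i l, i ∈ G l ↔ π i = l := by
      refine fun i l => ⟨fun hi => ?_, fun h => h ▸ hπmem i⟩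
      rcases lt_trichotomy (π i) l with h | h | h
      · exact absurd hi (Finset.disjoint_left.1 (hG_disj _ _ h) (hπmem i))
      · exact h
      · exact absurd (hπmem i) (Finset.disjoint_left.1 (hG_disj _ _ h) hi)
    refine ⟨SGLasso.solutionSet_nonempty hπ hw hlam1 hpos, fun r hr => ?_⟩
    obtain ⟨κ, hκ, h⟩ := SGLasso.exists_infDist_solutionSet_le (A := A) (b := b) hπ hw hlam1 hpos hr
    exact ⟨κ, hκ, fun x hx => ⟨SGLasso.optimalityMap_nonempty hπ hw hlam1 hlam2 x, h x hx⟩⟩
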